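/- Let $\mathbb F_q$ be a finite field. For a linear code $C\subseteq\mathbb F_q^n$ (a linear subspace), a real $\rho$ and an integer $\ell\ge 1$, say that $C$ is $(\rho,\ell)$-average-radius list-decodable if for every $y\in\mathbb F_q^n$ and all pairwise distinct $c_0,\dots,c_\ell\in C$, $$\frac1{\ell+1}\sum_{i=0}^{\ell}\operatorname{wt}(y-c_i)>\rho n,$$ where $\operatorname{wt}$ is the Hamming weight. For a real $d\ge 0$, say that $C$ is $\mathrm{rLD\text{-}MDS}_d(\le L)$ if for every $\ell\in\{1,\dots,L\}$ it is $(\rho_\ell,\ell)$-average-radius list-decodable with $\rho_\ell=\frac{\ell}{\ell+1}\cdot\frac{n-\dim C-d}{n}$. Theorem. For every real $\varepsilon>0$, every rate $0<R\le 1$ and every integer $L\ge 1$ there is $n_0=n_0(\varepsilon,R,L)$ such that the following holds for every prime power $q\ge 2^{10L/\varepsilon}$, every $n\ge n_0$ and every integer $k\ge 0$ with $|k-Rn|<1$ (i.e. $k=Rn$, rounded up or down to an integer). Let $G\in\mathbb F_q^{k\times n}$ be uniformly random (its $n$ columns are independent and uniform in $\mathbb F_q^k$), and let $C\subseteq\mathbb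 F_q^n$ be the random linear code spanned by its rows. Then $$\Pr\bigl[\,C\text{ is }\mathrm{rLD\text{-}MDS}_{\varepsilon n}(\le L)\,\bigr]\ \ge\ 1-2^{-Ln}.$$ If moreover $R+\varepsilon\le 1$, then with probability at least $1-2^{-Ln}$ the code $C$ both has dimension exactly $k$ and is $\mathrm{rLD\text{-}MDS}_{\varepsilon n}(\le L)$. -/

import Mathlib

noncomputable section

/-- The linear code of length `n` generated by the rows of the `k × n` matrix `G`. -/
def rowCode {F : Type*} [Field F] {k n : ℕ} (G : Matrix (Fin k) (Fin n) F) :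
    Submodule F (Fin n → F) :=
  Submodule.span F (Set.range G.row)

/-- `C` is `(ρ, L)`-average-radius list-decodable: no `L + 1` distinct codewords have average
Hamming distance at most `ρ n` from a common centre `y`. -/
def IsAvgRadiusListDecodable {F : Type*} [Field F] [DecidableEq F] {n : ℕ}
    (C : Submodule F (Fin n → F)) (ρ : ℝ) (L : ℕ) : Prop :=
  ∀ (y : Fin n → F) (c : Fin (L + 1) → (Fin n → F)),
    Function.Injective c → (∀ i, c i ∈ C) →
      ρ * (n : ℝ) < (1 / ((L : ℝ) + 1)) * ∑ i, (hammingDist y (c i) : ℝ)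

/-- The relaxed radius `ρ_{n,k,d}(L) = L / (L + 1) * (n - k - d) / n`. -/
def relaxedRadius (n k : ℕ) (d : ℝ) (L : ℕ) : ℝ :=
  (L : ℝ) / ((L : ℝ) + 1) * (((n : ℝ) - (k : ℝ) - d) / (n : ℝ))

/-- `C`, an `(n, k)`-code with `k = dim C`, is `rLD-MDS_d(L)`. -/
def IsRLDMDS {F : Type*} [Field F] [DecidableEq F] {n : ℕ}
    (C : Submodule F (Fin n → F)) (d : ℝ) (L : ℕ) : Prop :=
  IsAvgRadiusListDecodable C (relaxedRadius n (Module.finrank F C) d L) L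

/-- `C` is `rLD-MDS_d(≤ L)`. -/
def IsRLDMDSLe {F : Type*} [Field F] [DecidableEq F] {n : ℕ}
    (C : Submodule F (Fin n → F)) (d : ℝ) (L : ℕ) : Prop :=
  ∀ ℓ : ℕ, 1 ≤ ℓ → ℓ ≤ L → IsRLDMDS C d ℓ

/-- The probability of an event about a uniformly random matrix in `F^{k × n}`; equivalently, the
`n` columns are independent and uniform in `F^k`, with repetitions allowed. -/
def randomMatrixProb {F : Type*} [Field F] [Fintype F] {k n : ℕ}
    (E : Set (Matrix (Fin k) (Fin n) F)) : ℝ :=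
  ((PMF.uniformOfFintype (Matrix (Fin k) (Fin n) F)).toOuterMeasure E).toReal

end

/-!
A failure of list decodability of `C` at list size `ℓ` gives a centre `y` and distinct codewords
`c 0, …, c ℓ` whose agreement sets `I j = {i | y j = c i j}` satisfy `∑ j, (|I j| - 1) ≥ ℓ K`, where
`K = dim C + ε n`. If the `c i` are affinely independent, then a union bound over the agreement
sets and the messages suffices, since coordinate `j` imposes `|I j| - 1` independent linear
conditions on the `j`-th column of `G`. Affine dependencies among the `c i` are the only difficulty.

Among the sublists `J` with `|J| ≥ 2` and `∑ j, (|I j ∩ J| - 1) ≥ (|J| - 1) K`, where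
subtraction is truncated at `0`, take a smallest one. Since the inequality fails for all smaller
sublists, splitting `|A| - 1` along a partition shows that
`∑ j, (number of parts met by I j ∩ J, minus 1) ≥ (number of parts - 1) K` for every partition of `J`
(`exists_weaklyPartitionConnected`). Write the differences `c i - c i₀`, `i ∈ J`, in a basis chosen
among themselves, as vectors `T i` in `F ^ r`, and partition `J` by the position of the last nonzero
entry of `T i`. There are exactly `r + 1` parts, and points in distinct parts are affinely
independent, so that the span `D j` of the differences `T i - T i'`, `i, i' ∈ I j ∩ J`, has
dimension at least the number of parts met minus `1`
(`card_image_leadingPosition_sub_one_le`). Hence `∑ j, dim (D j) ≥ r K`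
(`exists_differenceSpan_configuration`).

For fixed `T` and fixed agreement sets, independent messages `w 1, …, w r` satisfy the conditions
given by the `D j` for a fraction `q ^ (-∑ j, dim (D j))` of all matrices
(`card_matrix_mul_pow_sum_finrank`). A matrix of rank `k - d` has `q ^ (d r)` lifts of each family of
`r` codewords to messages (`card_lift`), so a double count also covers matrices of deficient rank,
for which `K` is smaller, and bounds the fraction of bad matrices by `q ^ (-r ε n)`
(`ncard_constrained_le`). There are at most `L² q ^ (L (L + 1)) 2 ^ ((L + 1) n)` choices of
`ℓ`, `r`, `T` and the agreement sets, which is negligible for `q ≥ 2 ^ (10 L / ε)` and `n` large.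
Finally `G` has rank less than `k` with probability at most `q ^ (k - n)`.
-/

open Finset

/-! ### Weakly partition-connected sublists -/

theorem card_sub_one_eq_add_sum_fiber {ι κ : Type*} [DecidableEq κ]
    (A : Finset ι) (f : ι → κ) {B : Finset κ} (hB : A.image f ⊆ B) :
    #A - 1 = (#(A.image f) - 1) + ∑ b ∈ B, (#{i ∈ A | f i = b} - 1) := by
  have h1 : ∑ b ∈ B, (#{i ∈ A | f i = b} - 1) = ∑ b ∈ A.image f, (#{i ∈ A | f i = b} - 1) := by
    refine (sum_subset hB fun b _ hb => ?_).symm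
    have : #{i ∈ A | f i = b} = 0 := by
      rw [card_eq_zero, filter_eq_empty_iff]
      intro i hi h
      exact hb (mem_image.2 ⟨i, hi, h⟩)
    omega
  have h2 : ∑ b ∈ A.image f, (#{i ∈ A | f i = b} - 1) + #(A.image f) = #A := by
    rw [card_eq_sum_card_image f A, card_eq_sum_ones (A.image f), ← sum_add_distrib]
    refine sum_congr rfl fun b hb => ?_
    obtain ⟨i, hi, h⟩ := mem_image.1 hb
    have : 0 < #{i ∈ A | f i = b} := card_pos.2 ⟨i, mem_filter.2 ⟨hi, h⟩⟩
    omega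
  rcases A.eq_empty_or_nonempty with rfl | hA
  · simp
  · have := card_pos.2 (hA.image f)
    omega

/-- If a family of agreement sets has large total excess on a list `S`, then it has large total
excess across every partition (given by the fibres of `f`) of a suitable list `J` with at least two
entries, namely of a smallest list on which the excess is large. -/
theorem exists_weaklyPartitionConnected {ι σ : Type*} [DecidableEq ι] [Fintype σ]
    (I : σ → Finset ι) (K : ℝ) (S : Finset ι) (hS : 1 < #S)
    (h : ((#S : ℝ) - 1) * K ≤ ∑ j, ((#(I j ∩ S) - 1 : ℕ) : ℝ)) :
    ∃ J : Finset ι, 1 < #J ∧ ∀ {κ : Type} [DecidableEq κ] (f : ι → κ), 1 < #(J.image f) →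
      ((#(J.image f) : ℝ) - 1) * K ≤ ∑ j, ((#((I j ∩ J).image f) - 1 : ℕ) : ℝ) := by
  induction hm : #S using Nat.strong_induction_on generalizing S with
  | _ m ih =>
  -- Either a smaller sublist satisfies the same inequality, or `S` itself is the sublist.
  by_cases hex : ∃ S' : Finset ι, #S' < #S ∧ 1 < #S' ∧
      ((#S' : ℝ) - 1) * K ≤ ∑ j, ((#(I j ∩ S') - 1 : ℕ) : ℝ)
  · obtain ⟨S', h1, h2, h3⟩ := hex
    exact ih _ (hm ▸ h1) S' h2 h3 rfl
  push Not at hex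
  refine ⟨S, hS, fun {κ} _ f hf => ?_⟩
  -- A fibre of `f` is smaller than `S`, hence has small excess; a singleton has excess zero.
  have key : ∀ b ∈ S.image f, ∑ j, ((#{i ∈ I j ∩ S | f i = b} - 1 : ℕ) : ℝ) ≤
      ((#{i ∈ S | f i = b} : ℝ) - 1) * K := by
    intro b hb
    have hpos : 0 < #{i ∈ S | f i = b} := by
      obtain ⟨i, hi, h⟩ := mem_image.1 hb
      exact card_pos.2 ⟨i, mem_filter.2 ⟨hi, h⟩⟩
    have hlt : #{i ∈ S | f i = b} < #S := by
      refine card_lt_card (filter_ssubset.2 ?_)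
      obtain ⟨c, hc, hcb⟩ := exists_mem_ne hf b
      obtain ⟨i, hi, h⟩ := mem_image.1 hc
      exact ⟨i, hi, fun h' => hcb (h.symm.trans h')⟩
    have heq : ∀ j, {i ∈ I j ∩ S | f i = b} = I j ∩ {i ∈ S | f i = b} := fun j => by
      ext i; simp [and_assoc]
    simp only [heq]
    rcases Nat.lt_or_ge 1 #{i ∈ S | f i = b} with h1 | h1
    · exact (hex _ hlt h1).le
    · have h1 : #{i ∈ S | f i = b} = 1 := by omega
      have : ∀ j, #(I j ∩ {i ∈ S | f i = b}) - 1 = 0 := fun j => by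
        have := card_le_card (inter_subset_right (s₁ := I j) (s₂ := {i ∈ S | f i = b}))
        omega
      simp [this, h1]
  have hsum : ∑ b ∈ S.image f, ((#{i ∈ S | f i = b} : ℝ) - 1) = #S - #(S.image f) := by
    rw [sum_sub_distrib, card_eq_sum_card_image f S]
    simp
  have hsplit : ∑ j, ((#(I j ∩ S) - 1 : ℕ) : ℝ) = ∑ j, ((#((I j ∩ S).image f) - 1 : ℕ) : ℝ) +
      ∑ b ∈ S.image f, ∑ j, ((#{i ∈ I j ∩ S | f i = b} - 1 : ℕ) : ℝ) := by
    rw [sum_comm, ← sum_add_distrib]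
    refine sum_congr rfl fun j _ => ?_
    rw [card_sub_one_eq_add_sum_fiber (I j ∩ S) f (image_subset_image inter_subset_right)]
    push_cast
    rfl
  have := sum_le_sum key
  rw [← sum_mul, hsum] at this
  nlinarith

/-! ### Leading positions and spans of differences -/

section LeadingPosition

variable {F ι : Type*} [Field F] {r : ℕ}

/-- The largest index at which `u` is nonzero, and `⊥` for `u = 0`. -/
noncomputable def leadingPosition (u : Fin r → F) : WithBot (Fin r) :=
  open Classical in Finset.max {a | u a ≠ 0}

/-- The span of all differences `T i - T i'` with `i, i' ∈ A`, that is, the direction of the affine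
span of the points `T i`, `i ∈ A`. -/
def differenceSpan (T : ι → Fin r → F) (A : Finset ι) : Submodule F (Fin r → F) :=
  Submodule.span F {u | ∃ i ∈ A, ∃ i' ∈ A, u = T i - T i'}

theorem apply_ne_zero_of_leadingPosition_eq {u : Fin r → F} {a : Fin r}
    (h : leadingPosition u = a) : u a ≠ 0 := by
  classical
  simpa using mem_of_max h

theorem apply_eq_zero_of_leadingPosition_lt {u : Fin r → F} {a : Fin r}
    (h : leadingPosition u < a) : u a = 0 := by
  classical
  by_contra hne
  exact absurd h (not_lt.2 (le_max (by simpa using hne)))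

theorem leadingPosition_single (a : Fin r) :
    leadingPosition (Pi.single a (1 : F) : Fin r → F) = a := by
  classical
  have : ({b | (Pi.single a (1 : F) : Fin r → F) b ≠ 0} : Finset (Fin r)) = {a} := by
    ext b; simp [Pi.single_apply]
  unfold leadingPosition
  convert max_singleton using 2

theorem leadingPosition_zero : leadingPosition (0 : Fin r → F) = ⊥ := by
  simp [leadingPosition]

theorem linearIndependent_of_apply_ne_zero {P : Set (Fin r)} (u : P → Fin r → F)
    (h₁ : ∀ a, u a a ≠ 0) (h₂ : ∀ (a : P) (b : Fin r), (a : Fin r) < b → u a b = 0) :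
    LinearIndependent F u := by
  classical
  rw [linearIndependent_iff']
  intro s g hg a ha
  by_contra hne
  -- Evaluate the relation at the largest index carrying a nonzero coefficient.
  obtain ⟨m, hm, hmax⟩ := exists_max_image {b ∈ s | g b ≠ 0} (fun b => (b : Fin r))
    ⟨a, mem_filter.2 ⟨ha, hne⟩⟩
  rw [mem_filter] at hm
  have := congrFun hg m
  rw [Finset.sum_apply, sum_eq_single_of_mem m hm.1] at this
  · simp [hm.2, h₁ m] at this
  · intro b hb hbm
    by_cases hgb : g b = 0
    · simp [hgb]
    · have hle := hmax b (mem_filter.2 ⟨hb, hgb⟩)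
      have : (b : Fin r) < m := lt_of_le_of_ne hle fun h => hbm (Subtype.ext h)
      simp [h₂ b m this]

/-- Points with distinct leading positions are affinely independent: after subtracting a point of
least leading position, all larger leading positions are unchanged. -/
theorem card_image_leadingPosition_sub_one_le (T : ι → Fin r → F) (A : Finset ι) :
    #(A.image fun i => leadingPosition (T i)) - 1 ≤ Module.finrank F (differenceSpan T A) := by
  classical
  rcases A.eq_empty_or_nonempty with rfl | hA
  · simp
  obtain ⟨i₀, hi₀, hmin⟩ := exists_min_image A (fun i => leadingPosition (T i)) hA
  set P : Finset (Fin r) :=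
    {a | leadingPosition (T i₀) < a ∧ ∃ i ∈ A, leadingPosition (T i) = a} with hP
  have hcard : #(A.image fun i => leadingPosition (T i)) - 1 ≤ #P := by
    have hsub : (A.image fun i => leadingPosition (T i)).erase (leadingPosition (T i₀)) ⊆
        P.image (fun a : Fin r => (a : WithBot (Fin r))) := by
      intro b hb
      obtain ⟨hb₀, hb⟩ := mem_erase.1 hb
      obtain ⟨i, hi, rfl⟩ := mem_image.1 hb
      have hlt := lt_of_le_of_ne (hmin i hi) (Ne.symm hb₀)
      obtain ⟨a, ha⟩ := WithBot.ne_bot_iff_exists.1 (ne_bot_of_gt hlt)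
      refine mem_image.2 ⟨a, ?_, ha⟩
      simp only [hP, mem_filter, mem_univ, true_and]
      exact ⟨ha ▸ hlt, i, hi, ha.symm⟩
    have := (card_le_card hsub).trans card_image_le
    rwa [card_erase_of_mem (mem_image_of_mem _ hi₀)] at this
  refine hcard.trans ?_
  have hex : ∀ a : (P : Set (Fin r)), ∃ i ∈ A, leadingPosition (T i) = (a : Fin r) := fun a =>
    (mem_filter.1 a.2).2.2
  choose p hpA hp using hex
  have hlt : ∀ a : (P : Set (Fin r)), leadingPosition (T i₀) < (a : Fin r) := fun a =>
    (mem_filter.1 a.2).2.1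
  have hind : LinearIndependent F fun a : (P : Set (Fin r)) => T (p a) - T i₀ := by
    refine linearIndependent_of_apply_ne_zero _ (fun a => ?_) fun a b hab => ?_
    · simpa [apply_eq_zero_of_leadingPosition_lt (hlt a)] using
        apply_ne_zero_of_leadingPosition_eq (hp a)
    · have hab' : ((a : Fin r) : WithBot (Fin r)) < b := WithBot.coe_lt_coe.2 hab
      have h1 := apply_eq_zero_of_leadingPosition_lt ((hp a).trans_lt hab')
      have h2 := apply_eq_zero_of_leadingPosition_lt ((hlt a).trans hab')
      simp [h1, h2]
  have hrange : Submodule.span F (Set.range fun a : (P : Set (Fin r)) => T (p a) - T i₀) ≤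
      differenceSpan T A := by
    refine Submodule.span_mono ?_
    rintro _ ⟨a, rfl⟩
    exact ⟨p a, hpA a, i₀, hi₀, rfl⟩
  have := Submodule.finrank_mono hrange
  rw [finrank_span_eq_card hind] at this
  simpa using this

end LeadingPosition

/-! ### The linear configuration produced by a failure of list decodability -/

/-- A list of codewords violating the average-radius bound yields `r` independent codewords `v a`
subject to at least `r K` linear conditions in total, with conditions determined by the coefficient
vectors `T i` and the sets `I j` alone. -/
theorem exists_differenceSpan_configuration {F : Type*} [Field F] [DecidableEq F] {n ℓ : ℕ}
    (hℓ : 1 ≤ ℓ) (C : Submodule F (Fin n → F)) (K : ℝ) (y : Fin n → F)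
    (c : Fin (ℓ + 1) → Fin n → F) (hc : Function.Injective c) (hC : ∀ i, c i ∈ C)
    (h : ∑ i, (hammingDist y (c i) : ℝ) ≤ ℓ * ((n : ℝ) - K)) :
    ∃ r : ℕ, 1 ≤ r ∧ r ≤ ℓ ∧ ∃ (T : Fin (ℓ + 1) → Fin r → F) (I : Fin n → Finset (Fin (ℓ + 1)))
      (v : Fin r → Fin n → F), LinearIndependent F v ∧ (∀ a, v a ∈ C) ∧
      (∀ j, ∀ u ∈ differenceSpan T (I j), ∑ a, u a * v a j = 0) ∧
      r * K ≤ ∑ j, (Module.finrank F (differenceSpan T (I j)) : ℝ) := by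
  set I : Fin n → Finset (Fin (ℓ + 1)) := fun j => {i | y j = c i j} with hI
  have hcount : ∑ i, (hammingDist y (c i) : ℝ) + ∑ j, (#(I j) : ℝ) = (ℓ + 1) * n := by
    have h1 : ∑ j, #(I j) = ∑ i, #{j | y j = c i j} := by
      simp only [hI, card_filter]
      exact sum_comm
    have h2 : ∀ i, hammingDist y (c i) + #{j | y j = c i j} = n := fun i => by
      rw [hammingDist, add_comm, card_filter_add_card_filter_not, card_univ, Fintype.card_fin]
    have h3 : ∑ i, hammingDist y (c i) + ∑ j, #(I j) = (ℓ + 1) * n := by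
      rw [h1, ← sum_add_distrib, sum_congr rfl fun i _ => h2 i]
      simp
    exact_mod_cast h3
  -- The truncated `#(I j) - 1` only exceeds the real one, so empty agreement sets do no harm.
  have hstart : ((#(univ : Finset (Fin (ℓ + 1))) : ℝ) - 1) * K ≤
      ∑ j, ((#(I j ∩ univ) - 1 : ℕ) : ℝ) := by
    have h1 : ∀ j ∈ univ, (#(I j) : ℝ) - 1 ≤ ((#(I j ∩ univ) - 1 : ℕ) : ℝ) := fun j _ => by
      rw [inter_univ, sub_le_iff_le_add]
      exact_mod_cast le_tsub_add
    have h2 := sum_le_sum h1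
    rw [sum_sub_distrib] at h2
    simp only [sum_const, card_univ, Fintype.card_fin, nsmul_eq_mul, mul_one] at h2 ⊢
    push_cast
    linarith
  obtain ⟨J, hJ, hpart⟩ := exists_weaklyPartitionConnected I K univ
    (by rw [card_univ, Fintype.card_fin]; omega) hstart
  obtain ⟨i₀, hi₀⟩ := card_pos.1 (zero_lt_one.trans hJ)
  set S : Set (Fin n → F) := (fun i => c i - c i₀) '' J with hS
  obtain ⟨r, v, hvS, hvspan, hvind⟩ : ∃ (r : ℕ) (v : Fin r → Fin n → F), (∀ a, v a ∈ S) ∧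
      Submodule.span F (Set.range v) = Submodule.span F S ∧ LinearIndependent F v :=
    ⟨_, Submodule.exists_fun_fin_finrank_span_eq F S⟩
  choose p hpJ hp using hvS
  -- Outside `J` the coordinate vectors `T i` are arbitrary: only `I j ∩ J` is used below.
  have hcoord : ∀ i, ∃ t : Fin r → F, i ∈ J → ∑ a, t a • v a = c i - c i₀ := fun i => by
    by_cases hi : i ∈ J
    · have : c i - c i₀ ∈ Submodule.span F (Set.range v) := by
        rw [hvspan]
        exact Submodule.subset_span ⟨i, hi, rfl⟩
      obtain ⟨t, ht⟩ := (Submodule.mem_span_range_iff_exists_fun F).1 this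
      exact ⟨t, fun _ => ht⟩
    · exact ⟨0, fun h => absurd h hi⟩
  choose T hT using hcoord
  have huniq : ∀ t t' : Fin r → F, ∑ a, t a • v a = ∑ a, t' a • v a → t = t' := fun t t' h =>
    hvind.fintypeLinearCombination_injective (by simpa [Fintype.linearCombination_apply])
  have hT₀ : T i₀ = 0 := huniq _ _ (by rw [hT i₀ hi₀]; simp)
  have hTp : ∀ a, T (p a) = Pi.single a 1 := fun a =>
    huniq _ _ (by rw [hT _ (hpJ a)]; simpa [Pi.single_apply] using hp a)
  have himage : J.image (fun i => leadingPosition (T i)) = univ := by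
    refine eq_univ_of_forall fun b => ?_
    induction b using WithBot.recBotCoe with
    | bot => exact mem_image.2 ⟨i₀, hi₀, by rw [hT₀, leadingPosition_zero]⟩
    | coe a => exact mem_image.2 ⟨p a, hpJ a, by rw [hTp, leadingPosition_single]⟩
  have hcard : #(J.image fun i => leadingPosition (T i)) = r + 1 := by
    rw [himage, card_univ]
    exact (Fintype.card_option).trans (by rw [Fintype.card_fin])
  have hr1 : 1 ≤ r := by
    by_contra! h0
    obtain ⟨i, hi, hne⟩ := exists_mem_ne hJ i₀
    have h1 := hT i hi
    have : IsEmpty (Fin r) := by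
      rw [Nat.lt_one_iff.1 h0]
      infer_instance
    rw [univ_eq_empty, sum_empty] at h1
    exact hne (hc (sub_eq_zero.1 h1.symm))
  have hrℓ : r ≤ ℓ := by
    have h1 : #(J.image fun i => leadingPosition (T i)) ≤ #J := card_image_le
    have h2 : #J ≤ ℓ + 1 := (card_le_univ J).trans_eq (Fintype.card_fin _)
    omega
  refine ⟨r, hr1, hrℓ, T, fun j => I j ∩ J, v, hvind, fun a => ?_, fun j u hu => ?_, ?_⟩
  · rw [← hp a]
    exact C.sub_mem (hC _) (hC _)
  · induction hu using Submodule.span_induction with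
    | mem u hu =>
      obtain ⟨i, hi, i', hi', rfl⟩ := hu
      obtain ⟨hiI, hiJ⟩ := mem_inter.1 hi
      obtain ⟨hiI', hiJ'⟩ := mem_inter.1 hi'
      have h1 : y j = c i j := (mem_filter.1 hiI).2
      have h2 : y j = c i' j := (mem_filter.1 hiI').2
      have h3 := congrFun (hT i hiJ) j
      have h4 := congrFun (hT i' hiJ') j
      simp only [Finset.sum_apply, Pi.smul_apply, smul_eq_mul, Pi.sub_apply] at h3 h4
      simp only [Pi.sub_apply, sub_mul, sum_sub_distrib, h3, h4, ← h1, ← h2, sub_self]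
    | zero => simp
    | add u u' _ _ h h' => simp [add_mul, sum_add_distrib, h, h']
    | smul t u _ h => simp [mul_assoc, ← mul_sum, h]
  · have h1 := hpart (fun i => leadingPosition (T i)) (by rw [hcard]; omega)
    rw [hcard] at h1
    push_cast at h1
    rw [add_sub_cancel_right] at h1
    refine h1.trans (sum_le_sum fun j _ => ?_)
    exact_mod_cast card_image_leadingPosition_sub_one_le T (I j ∩ J)

/-! ### Counting matrices -/

theorem rowCode_eq_range {F : Type*} [Field F] {k n : ℕ} (G : Matrix (Fin k) (Fin n) F) :
    rowCode G = LinearMap.range G.vecMulLinear := by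
  rw [range_vecMulLinear]
  rfl

section Counting

variable {F : Type*} [Field F] [Fintype F] {k n r : ℕ}

/-- A column satisfying the constraints indexed by `D` lies in a subspace of codimension `dim D`
when the `w a` are linearly independent. -/
theorem card_column_mul_pow_finrank (D : Submodule F (Fin r → F)) {w : Fin r → Fin k → F}
    (hw : LinearIndependent F w) :
    Nat.card {g : Fin k → F // ∀ u ∈ D, ∑ a, u a * (w a ⬝ᵥ g) = 0} *
      Fintype.card F ^ Module.finrank F D = Fintype.card F ^ k := by
  classical
  set φ : (Fin r → F) →ₗ[F] Module.Dual F (Fin k → F) :=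
    (dotProductEquiv F (Fin k)).toLinearMap ∘ₗ Fintype.linearCombination F w with hφ
  have hinj : Function.Injective φ :=
    (dotProductEquiv F (Fin k)).injective.comp hw.fintypeLinearCombination_injective
  have happ : ∀ u g, φ u g = ∑ a, u a * (w a ⬝ᵥ g) := fun u g => by
    simp [hφ, Fintype.linearCombination_apply]
  set N : Submodule F (Fin k → F) := (D.map φ).dualCoannihilator
  have hN : ∀ g, g ∈ N ↔ ∀ u ∈ D, ∑ a, u a * (w a ⬝ᵥ g) = 0 := fun g => by
    simp [N, Submodule.mem_dualCoannihilator, happ]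
  have hdim : Module.finrank F D + Module.finrank F N = k := by
    have h1 := Subspace.finrank_add_finrank_dualCoannihilator_eq (D.map φ)
    rwa [← (Submodule.equivMapOfInjective φ hinj D).finrank_eq, Module.finrank_fin_fun] at h1
  have hcard : Nat.card {g : Fin k → F // ∀ u ∈ D, ∑ a, u a * (w a ⬝ᵥ g) = 0} = Nat.card N :=
    Nat.card_congr (Equiv.subtypeEquivRight fun g => (hN g).symm)
  rw [hcard, Module.natCard_eq_pow_finrank (K := F), Nat.card_eq_fintype_card, ← pow_add,
    add_comm, hdim]

/-- The columns can be chosen independently, so `card_column_mul_pow_finrank` multiplies up. -/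
theorem card_matrix_mul_pow_sum_finrank (D : Fin n → Submodule F (Fin r → F))
    {w : Fin r → Fin k → F} (hw : LinearIndependent F w) :
    Nat.card {G : Matrix (Fin k) (Fin n) F //
        ∀ j, ∀ u ∈ D j, ∑ a, u a * Matrix.vecMul (w a) G j = 0} *
      Fintype.card F ^ (∑ j, Module.finrank F (D j)) = Fintype.card F ^ (k * n) := by
  have e : {G : Matrix (Fin k) (Fin n) F //
      ∀ j, ∀ u ∈ D j, ∑ a, u a * Matrix.vecMul (w a) G j = 0} ≃
      ∀ j, {g : Fin k → F // ∀ u ∈ D j, ∑ a, u a * (w a ⬝ᵥ g) = 0} :=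
    { toFun := fun G j => ⟨fun i => G.1 i j, G.2 j⟩
      invFun := fun g => ⟨Matrix.of fun i j => (g j).1 i, fun j => (g j).2⟩
      left_inv := fun G => rfl
      right_inv := fun g => rfl }
  rw [Nat.card_congr e, Nat.card_pi, ← prod_pow_eq_pow_sum, ← prod_mul_distrib,
    prod_congr rfl fun j _ => card_column_mul_pow_finrank (D j) hw]
  simp [pow_mul]

/-- Every family of codewords is the image of `q ^ ((k - rank G) r)` families of messages. -/
theorem card_lift (G : Matrix (Fin k) (Fin n) F) {v : Fin r → Fin n → F}
    (hv : ∀ a, v a ∈ rowCode G) :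
    Nat.card {w : Fin r → Fin k → F // ∀ a, Matrix.vecMul (w a) G = v a} =
      Fintype.card F ^ ((k - Module.finrank F (rowCode G)) * r) := by
  classical
  rw [rowCode_eq_range] at hv
  choose w₀ hw₀ using hv
  have e : {w : Fin r → Fin k → F // ∀ a, Matrix.vecMul (w a) G = v a} ≃
      (Fin r → LinearMap.ker G.vecMulLinear) :=
    { toFun := fun w a => ⟨w.1 a - w₀ a, by
        rw [LinearMap.mem_ker, map_sub, hw₀, sub_eq_zero]; exact w.2 a⟩
      invFun := fun x => ⟨fun a => x a + w₀ a, fun a => by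
        have := (x a).2
        rw [LinearMap.mem_ker] at this
        have h := map_add G.vecMulLinear (x a : Fin k → F) (w₀ a)
        rw [this, hw₀, zero_add] at h
        exact h⟩
      left_inv := fun w => by ext; simp
      right_inv := fun x => by ext; simp }
  have hker : Module.finrank F (LinearMap.ker G.vecMulLinear) =
      k - Module.finrank F (rowCode G) := by
    have := LinearMap.finrank_range_add_finrank_ker G.vecMulLinear
    rw [Module.finrank_fin_fun] at this
    rw [rowCode_eq_range]
    omega
  rw [Nat.card_congr e, Nat.card_fun, Nat.card_fin, Module.natCard_eq_pow_finrank (K := F), hker,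
    Nat.card_eq_fintype_card, pow_mul]

/-- For fixed constraint spaces `D j`, the matrices whose row code has a family of `r` independent
codewords obeying the constraints, and whose rank is small compared with the total dimension of the
constraints, are rare. A matrix of rank `k - d` is counted once for each of the `q ^ (d r)` lifts of
its family of codewords to messages, which makes up for the weaker assumption on `∑ j, dim D j`. -/
theorem ncard_constrained_le (D : Fin n → Submodule F (Fin r → F)) (δ : ℝ) :
    ({G : Matrix (Fin k) (Fin n) F | (∃ v : Fin r → Fin n → F, LinearIndependent F v ∧
        (∀ a, v a ∈ rowCode G) ∧ ∀ j, ∀ u ∈ D j, ∑ a, u a * v a j = 0) ∧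
      r * (Module.finrank F (rowCode G) + δ) ≤
        ∑ j, (Module.finrank F (D j) : ℝ)}.ncard : ℝ) ≤
      (Fintype.card F : ℝ) ^ ((k : ℝ) * n - r * δ) := by
  classical
  set q : ℝ := (Fintype.card F : ℝ) with hq
  have hq1 : 1 ≤ q := Nat.one_le_cast.2 Fintype.card_pos
  have hq0 : 0 < q := one_pos.trans_le hq1
  set s : ℝ := ∑ j, (Module.finrank F (D j) : ℝ) with hs
  rw [Set.ncard_eq_toFinset_card']
  set B := Set.toFinset {G : Matrix (Fin k) (Fin n) F | (∃ v : Fin r → Fin n → F,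
      LinearIndependent F v ∧ (∀ a, v a ∈ rowCode G) ∧ ∀ j, ∀ u ∈ D j, ∑ a, u a * v a j = 0) ∧
    r * (Module.finrank F (rowCode G) + δ) ≤ s} with hB
  set W : Finset (Fin r → Fin k → F) := {w | LinearIndependent F w}
  set Rel : Matrix (Fin k) (Fin n) F → (Fin r → Fin k → F) → Prop := fun G w =>
    ∀ j, ∀ u ∈ D j, ∑ a, u a * Matrix.vecMul (w a) G j = 0 with hRel
  -- All lifts of the independent codewords `v a` to messages are independent.
  have habove : ∀ G ∈ B, q ^ ((k : ℝ) * r + r * δ - s) ≤ #(W.bipartiteAbove Rel G) := by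
    intro G hG
    obtain ⟨⟨v, hv, hvC, hvD⟩, hrank⟩ := Set.mem_toFinset.1 hG
    have h1 := card_lift G hvC
    rw [Nat.card_eq_fintype_card, Fintype.card_subtype] at h1
    have h2 : ({w : Fin r → Fin k → F | ∀ a, Matrix.vecMul (w a) G = v a} : Finset _) ⊆
        W.bipartiteAbove Rel G := by
      intro w hw
      have hw := (mem_filter.1 hw).2
      rw [mem_bipartiteAbove]
      refine ⟨mem_filter.2 ⟨mem_univ _, ?_⟩, fun j u hu => ?_⟩
      · refine LinearIndependent.of_comp G.vecMulLinear ?_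
        convert hv using 1
        exact funext hw
      · simpa only [hw] using hvD j u hu
    have h3 : q ^ (((k - Module.finrank F (rowCode G)) * r : ℕ) : ℝ) ≤
        #(W.bipartiteAbove Rel G) := by
      rw [Real.rpow_natCast, hq]
      exact_mod_cast h1 ▸ card_le_card h2
    refine le_trans (Real.rpow_le_rpow_of_exponent_le hq1 ?_) h3
    have h4 : (k : ℝ) - Module.finrank F (rowCode G) ≤
        ((k - Module.finrank F (rowCode G) : ℕ) : ℝ) := by
      rw [sub_le_iff_le_add]
      exact_mod_cast le_tsub_add
    have h5 := mul_le_mul_of_nonneg_right h4 (Nat.cast_nonneg (α := ℝ) r)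
    push_cast
    linarith
  have hbelow : ∀ w ∈ W, (#(B.bipartiteBelow Rel w) : ℝ) ≤ q ^ ((k : ℝ) * n - s) := by
    intro w hw
    have h1 := card_matrix_mul_pow_sum_finrank D (mem_filter.1 hw).2
    rw [Nat.card_eq_fintype_card, Fintype.card_subtype] at h1
    have h2 : #(B.bipartiteBelow Rel w) ≤ #{G | Rel G w} :=
      card_le_card fun G hG => mem_filter.2 ⟨mem_univ _, (mem_filter.1 hG).2⟩
    rw [Real.rpow_sub hq0, le_div_iff₀ (Real.rpow_pos_of_pos hq0 _)]
    have h3 : (#{G | Rel G w} : ℝ) * q ^ s = q ^ ((k : ℝ) * n) := by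
      rw [hs, ← Nat.cast_sum, Real.rpow_natCast, ← Nat.cast_mul, Real.rpow_natCast, hq]
      exact_mod_cast h1
    rw [← h3]
    gcongr
  have hmain := card_nsmul_le_card_nsmul Rel habove hbelow
  have hW : (#W : ℝ) ≤ q ^ ((k : ℝ) * r) := by
    have h1 : #W ≤ Fintype.card F ^ (k * r) := by
      refine (card_le_univ W).trans_eq ?_
      simp [pow_mul]
    rw [← Nat.cast_mul, Real.rpow_natCast, hq]
    exact_mod_cast h1
  rw [nsmul_eq_mul, nsmul_eq_mul, ← le_div_iff₀ (Real.rpow_pos_of_pos hq0 _)] at hmain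
  refine hmain.trans ?_
  rw [div_le_iff₀ (Real.rpow_pos_of_pos hq0 _), ← Real.rpow_add hq0]
  refine (mul_le_mul_of_nonneg_right hW (Real.rpow_nonneg hq0.le _)).trans_eq ?_
  rw [← Real.rpow_add hq0]
  congr 1
  ring

/-- Rank deficiency: some nonzero message is mapped to `0`. -/
theorem ncard_finrank_rowCode_ne_le :
    ({G : Matrix (Fin k) (Fin n) F | Module.finrank F (rowCode G) ≠ k}.ncard : ℝ) ≤
      (Fintype.card F : ℝ) ^ ((k : ℝ) * n + k - n) := by
  classical
  set q : ℝ := (Fintype.card F : ℝ) with hq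
  have hq0 : 0 < q := Nat.cast_pos.2 Fintype.card_pos
  set W : Finset (Fin k → F) := {w | w ≠ 0}
  have hsub : {G : Matrix (Fin k) (Fin n) F | Module.finrank F (rowCode G) ≠ k}.toFinset ⊆
      W.biUnion fun w => {G | Matrix.vecMul w G = 0} := by
    intro G hG
    have hG : Module.finrank F (rowCode G) ≠ k := Set.mem_toFinset.1 hG
    have hker : LinearMap.ker G.vecMulLinear ≠ ⊥ := fun h => hG <| by
      rw [rowCode_eq_range, LinearMap.finrank_range_of_inj (LinearMap.ker_eq_bot.1 h),
        Module.finrank_fin_fun]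
    obtain ⟨w, hw, hw0⟩ := Submodule.exists_mem_ne_zero_of_ne_bot hker
    exact mem_biUnion.2 ⟨w, by simpa [W] using hw0, by simpa using hw⟩
  have hone : ∀ w ∈ W, #({G : Matrix (Fin k) (Fin n) F | Matrix.vecMul w G = 0} : Finset _) *
      Fintype.card F ^ n = Fintype.card F ^ (k * n) := by
    intro w hw
    have hw : w ≠ 0 := (mem_filter.1 hw).2
    have h := card_matrix_mul_pow_sum_finrank (fun _ : Fin n => (⊤ : Submodule F (Fin 1 → F)))
      (w := fun _ => w) (linearIndependent_unique_iff.2 hw)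
    simp only [finrank_top, Module.finrank_fin_fun, sum_const, card_univ, Fintype.card_fin,
      smul_eq_mul, mul_one] at h
    rw [← h, Nat.card_eq_fintype_card, Fintype.card_subtype]
    congr 2
    ext G
    simp only [mem_filter, mem_univ, true_and, univ_unique, sum_singleton, Submodule.mem_top,
      forall_const, funext_iff, Pi.zero_apply]
    exact forall_congr' fun j => ⟨fun h u => by rw [h, mul_zero], fun h => by simpa using h 1⟩
  have hcard : {G : Matrix (Fin k) (Fin n) F | Module.finrank F (rowCode G) ≠ k}.ncard *
      Fintype.card F ^ n ≤ Fintype.card F ^ k * Fintype.card F ^ (k * n) := by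
    rw [Set.ncard_eq_toFinset_card']
    refine (Nat.mul_le_mul_right _ ((card_le_card hsub).trans card_biUnion_le)).trans ?_
    rw [sum_mul, sum_congr rfl hone, sum_const, smul_eq_mul]
    refine Nat.mul_le_mul_right _ ((card_le_univ W).trans_eq ?_)
    simp
  rw [Real.rpow_sub hq0, le_div_iff₀ (Real.rpow_pos_of_pos hq0 _), add_comm, Real.rpow_add hq0,
    ← Nat.cast_mul]
  simp only [Real.rpow_natCast, hq]
  exact_mod_cast hcard

end Counting

/-! ### The union bound -/

theorem ncard_iUnion_le_card_mul {ι α : Type*} [Fintype ι] [Finite α] (s : ι → Set α) {b : ℝ}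
    (h : ∀ i, ((s i).ncard : ℝ) ≤ b) : ((⋃ i, s i).ncard : ℝ) ≤ Fintype.card ι * b := by
  have h1 : ((⋃ i, s i).ncard : ℝ) ≤ ∑ i, ((s i).ncard : ℝ) := by
    exact_mod_cast Set.ncard_iUnion_le_of_fintype s
  refine h1.trans ((sum_le_sum fun i _ => h i).trans_eq ?_)
  simp

theorem ncard_not_isRLDMDSLe_le {F : Type*} [Field F] [Fintype F] [DecidableEq F] {k n : ℕ}
    (hn : 0 < n) (L : ℕ) {d : ℝ} (hd : 0 ≤ d) :
    ({G : Matrix (Fin k) (Fin n) F | ¬ IsRLDMDSLe (rowCode G) d L}.ncard : ℝ) ≤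
      L * (L * ((Fintype.card F : ℝ) ^ (((L : ℝ) + 1) * L) * ((2 : ℝ) ^ (((L : ℝ) + 1) * n) *
        (Fintype.card F : ℝ) ^ ((k : ℝ) * n - d)))) := by
  classical
  have hq1 : (1 : ℝ) ≤ Fintype.card F := Nat.one_le_cast.2 Fintype.card_pos
  have hq0 : (0 : ℝ) < Fintype.card F := one_pos.trans_le hq1
  -- The indices `ℓ r : Fin L` stand for the list size `ℓ + 1` and the dimension `r + 1`.
  set E : ∀ ℓ r : Fin L, (Fin (ℓ + 1 + 1) → Fin (r + 1) → F) →
      (Fin n → Finset (Fin (ℓ + 1 + 1))) → Set (Matrix (Fin k) (Fin n) F) := fun ℓ r T I =>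
    {G | (∃ v : Fin (r + 1) → Fin n → F, LinearIndependent F v ∧ (∀ a, v a ∈ rowCode G) ∧
        ∀ j, ∀ u ∈ differenceSpan T (I j), ∑ a, u a * v a j = 0) ∧
      (r + 1 : ℕ) * (Module.finrank F (rowCode G) + d) ≤
        ∑ j, (Module.finrank F (differenceSpan T (I j)) : ℝ)} with hE
  have hsub : {G : Matrix (Fin k) (Fin n) F | ¬ IsRLDMDSLe (rowCode G) d L} ⊆
      ⋃ ℓ, ⋃ r, ⋃ T, ⋃ I, E ℓ r T I := by
    intro G hG
    simp only [IsRLDMDSLe, IsRLDMDS, IsAvgRadiusListDecodable, Set.mem_ofPred_eq] at hG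
    push Not at hG
    obtain ⟨ℓ, hℓ1, hℓL, y, c, hc, hC, hle⟩ := hG
    have hsum : ∑ i, (hammingDist y (c i) : ℝ) ≤
        ℓ * ((n : ℝ) - (Module.finrank F (rowCode G) + d)) := by
      have hn' : (n : ℝ) ≠ 0 := by positivity
      have hℓ' : (0 : ℝ) < (ℓ : ℝ) + 1 := by positivity
      have h1 : relaxedRadius n (Module.finrank F (rowCode G)) d ℓ * n =
          1 / ((ℓ : ℝ) + 1) * (ℓ * ((n : ℝ) - (Module.finrank F (rowCode G) + d))) := by
        rw [relaxedRadius]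
        field_simp
        ring
      rw [h1] at hle
      exact le_of_mul_le_mul_left hle (by positivity)
    obtain ⟨r, hr1, hrℓ, T, I, v, hv, hvC, hvD, hdim⟩ :=
      exists_differenceSpan_configuration hℓ1 (rowCode G) _ y c hc hC hsum
    obtain ⟨ℓ, rfl⟩ := Nat.exists_eq_add_of_le' hℓ1
    obtain ⟨r, rfl⟩ := Nat.exists_eq_add_of_le' hr1
    simp only [Set.mem_iUnion]
    exact ⟨⟨ℓ, by omega⟩, ⟨r, by omega⟩, T, I, ⟨v, hv, hvC, hvD⟩, hdim⟩
  have hcard : ({G : Matrix (Fin k) (Fin n) F | ¬ IsRLDMDSLe (rowCode G) d L}.ncard : ℝ) ≤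
      ((⋃ ℓ, ⋃ r, ⋃ T, ⋃ I, E ℓ r T I).ncard : ℝ) :=
    Nat.cast_le.2 (Set.ncard_le_ncard hsub)
  refine hcard.trans ?_
  have hL : (L : ℝ) = Fintype.card (Fin L) := by simp
  refine (ncard_iUnion_le_card_mul _ fun ℓ => ncard_iUnion_le_card_mul _
    (b := (Fintype.card F : ℝ) ^ (((L : ℝ) + 1) * L) * ((2 : ℝ) ^ (((L : ℝ) + 1) * n) *
      (Fintype.card F : ℝ) ^ ((k : ℝ) * n - d))) fun r => ?_).trans_eq (by rw [← hL])
  have hℓL : ((ℓ : ℕ) : ℝ) + 1 ≤ L := by exact_mod_cast ℓ.2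
  have hrL : ((r : ℕ) : ℝ) + 1 ≤ L := by exact_mod_cast r.2
  refine (ncard_iUnion_le_card_mul _ (b := (2 : ℝ) ^ (((L : ℝ) + 1) * n) *
    (Fintype.card F : ℝ) ^ ((k : ℝ) * n - d)) fun T => ?_).trans ?_
  · refine (ncard_iUnion_le_card_mul _ (b := (Fintype.card F : ℝ) ^ ((k : ℝ) * n - d))
      fun I => ?_).trans ?_
    · refine (ncard_constrained_le _ d).trans (Real.rpow_le_rpow_of_exponent_le hq1 ?_)
      push_cast
      nlinarith [(r : ℕ).cast_nonneg (α := ℝ)]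
    · refine mul_le_mul_of_nonneg_right ?_ (Real.rpow_nonneg hq0.le _)
      have : (Fintype.card (Fin n → Finset (Fin (ℓ + 1 + 1))) : ℝ) =
          (2 : ℝ) ^ ((((ℓ : ℕ) : ℝ) + 1 + 1) * n) := by
        rw [Real.rpow_mul zero_le_two, Real.rpow_natCast]
        simp [← Real.rpow_natCast]
      rw [this]
      refine Real.rpow_le_rpow_of_exponent_le one_le_two ?_
      gcongr
  · refine mul_le_mul_of_nonneg_right ?_ (by positivity)
    have : (Fintype.card (Fin (ℓ + 1 + 1) → Fin (r + 1) → F) : ℝ) =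
        (Fintype.card F : ℝ) ^ ((((ℓ : ℕ) : ℝ) + 1 + 1) * (((r : ℕ) : ℝ) + 1)) := by
      rw [mul_comm, Real.rpow_mul hq0.le]
      simp only [Fintype.card_fun, Fintype.card_fin]
      push_cast
      simp only [← Real.rpow_natCast]
      push_cast
      rfl
    rw [this]
    refine Real.rpow_le_rpow_of_exponent_le hq1 ?_
    gcongr

theorem randomMatrixProb_eq_one_sub {F : Type*} [Field F] [Fintype F] {k n : ℕ}
    (E : Set (Matrix (Fin k) (Fin n) F)) :
    randomMatrixProb E = 1 - (Eᶜ.ncard : ℝ) / (Fintype.card F : ℝ) ^ ((k : ℝ) * n) := by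
  classical
  have hq : (0 : ℝ) < Fintype.card F := Nat.cast_pos.2 Fintype.card_pos
  have h1 : E.ncard + Eᶜ.ncard = Fintype.card F ^ (k * n) := by
    rw [Set.ncard_add_ncard_compl]
    change Nat.card (Fin k → Fin n → F) = _
    rw [Nat.card_fun, Nat.card_fun, Nat.card_fin, Nat.card_fin, Nat.card_eq_fintype_card, mul_comm,
      pow_mul]
  have h2 : (E.ncard : ℝ) + Eᶜ.ncard = (Fintype.card F : ℝ) ^ ((k : ℝ) * n) := by
    rw [← Nat.cast_mul, Real.rpow_natCast]
    exact_mod_cast h1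
  have h3 : (Fintype.card (Matrix (Fin k) (Fin n) F) : ℝ) =
      (Fintype.card F : ℝ) ^ ((k : ℝ) * n) := by
    rw [← h2, ← Nat.cast_add, Set.ncard_add_ncard_compl, Nat.card_eq_fintype_card]
  rw [randomMatrixProb, PMF.toOuterMeasure_uniformOfFintype_apply, ENNReal.toReal_div,
    ENNReal.toReal_natCast, ENNReal.toReal_natCast, h3, ← Nat.card_eq_fintype_card,
    Nat.card_coe_set_eq, eq_sub_iff_add_eq, ← add_div, h2]
  exact div_self (Real.rpow_pos_of_pos hq _).ne'

/-! ### The final estimate -/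

theorem mainTheorem11 (ε : ℝ) (hε : 0 < ε) (R : ℝ) (hR0 : 0 < R) (hR1 : R ≤ 1)
    (L : ℕ) (hL : 1 ≤ L) :
    ∃ n₀ : ℕ, ∀ (F : Type*) [Field F] [Fintype F] [DecidableEq F],
      (2 : ℝ) ^ (10 * (L : ℝ) / ε) ≤ (Fintype.card F : ℝ) →
      ∀ n : ℕ, n₀ ≤ n → ∀ k : ℕ, |(k : ℝ) - R * (n : ℝ)| < 1 →
        1 - (2 : ℝ) ^ (-((L : ℝ) * (n : ℝ))) ≤
            randomMatrixProb {G : Matrix (Fin k) (Fin n) F |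
              IsRLDMDSLe (rowCode G) (ε * (n : ℝ)) L} ∧
        (R + ε ≤ 1 →
          1 - (2 : ℝ) ^ (-((L : ℝ) * (n : ℝ))) ≤
            randomMatrixProb {G : Matrix (Fin k) (Fin n) F |
              Module.finrank F (rowCode G) = k ∧
                IsRLDMDSLe (rowCode G) (ε * (n : ℝ)) L}) := by
  refine ⟨⌈2 * (((L : ℝ) + 1) * L) / ε⌉₊, fun F _ _ _ hF n hn k hk => ?_⟩
  have hL' : (1 : ℝ) ≤ L := Nat.one_le_cast.2 hL
  have hεn : ((L : ℝ) + 1) * L ≤ ε * n / 2 := by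
    have := Nat.ceil_le.1 hn
    rw [div_le_iff₀ hε] at this
    linarith
  have hεn1 : 1 ≤ ε * n / 2 := by nlinarith
  have hn0 : 0 < n := by
    rcases Nat.eq_zero_or_pos n with rfl | h
    · norm_num at hεn1
    · exact h
  have hn1 : (1 : ℝ) ≤ n := Nat.one_le_cast.2 hn0
  have hLn : 1 ≤ (L : ℝ) * n := by nlinarith
  have hLLn : (L : ℝ) ≤ L * n := by nlinarith
  have hq1 : (1 : ℝ) ≤ Fintype.card F := Nat.one_le_cast.2 Fintype.card_pos
  have hq0 : (0 : ℝ) < Fintype.card F := one_pos.trans_le hq1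
  have hqkn : (0 : ℝ) < (Fintype.card F : ℝ) ^ ((k : ℝ) * n) := Real.rpow_pos_of_pos hq0 _
  -- Half of the exponent `ε n` pays for the factor `q ^ (L (L + 1))`, and the other half for the
  -- number of agreement patterns.
  have hhalf : (Fintype.card F : ℝ) ^ (-(ε * n / 2)) ≤ (2 : ℝ) ^ (-(5 * (L * n)) : ℝ) := by
    rw [Real.rpow_neg hq0.le, Real.rpow_neg zero_le_two]
    refine inv_anti₀ (Real.rpow_pos_of_pos two_pos _) ?_
    have h := Real.rpow_le_rpow (Real.rpow_nonneg zero_le_two _) hF (by positivity : 0 ≤ ε * n / 2)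
    rw [← Real.rpow_mul zero_le_two] at h
    rwa [show 10 * (L : ℝ) / ε * (ε * n / 2) = 5 * (L * n) by field_simp; norm_num] at h
  have hL2 : (2 : ℝ) * (L * L) ≤ 2 ^ (2 * (L * n) : ℝ) := by
    have h1 : (L : ℝ) * 2 ≤ 2 ^ (L : ℝ) := by
      obtain ⟨m, rfl⟩ := Nat.exists_eq_add_of_le' hL
      rw [Real.rpow_natCast, pow_succ]
      have : m + 1 ≤ 2 ^ m := Nat.lt_two_pow_self
      have : ((m + 1 : ℕ) : ℝ) ≤ 2 ^ m := by exact_mod_cast this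
      linarith
    calc (2 : ℝ) * (L * L) ≤ (L * 2) * (L * 2) := by nlinarith
      _ ≤ 2 ^ (L : ℝ) * 2 ^ (L : ℝ) := by gcongr
      _ = 2 ^ (2 * L : ℝ) := by rw [← Real.rpow_add two_pos, two_mul]
      _ ≤ 2 ^ (2 * (L * n) : ℝ) := by
        refine Real.rpow_le_rpow_of_exponent_le one_le_two ?_
        linarith
  have hbad : 2 * ({G : Matrix (Fin k) (Fin n) F |
        ¬ IsRLDMDSLe (rowCode G) (ε * n) L}.ncard : ℝ) ≤
      2 ^ (-(L * n) : ℝ) * (Fintype.card F : ℝ) ^ ((k : ℝ) * n) := by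
    have h := ncard_not_isRLDMDSLe_le (F := F) (k := k) hn0 L (d := ε * n) (by positivity)
    have h1 : (Fintype.card F : ℝ) ^ (((L : ℝ) + 1) * L) *
        (Fintype.card F : ℝ) ^ ((k : ℝ) * n - ε * n) ≤
        2 ^ (-(5 * (L * n)) : ℝ) * (Fintype.card F : ℝ) ^ ((k : ℝ) * n) := by
      refine le_trans ?_ (mul_le_mul_of_nonneg_right hhalf hqkn.le)
      rw [← Real.rpow_add hq0, ← Real.rpow_add hq0]
      refine Real.rpow_le_rpow_of_exponent_le hq1 ?_
      linarith
    have h2 : (2 : ℝ) ^ (((L : ℝ) + 1) * n) ≤ 2 ^ (2 * (L * n) : ℝ) := by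
      refine Real.rpow_le_rpow_of_exponent_le one_le_two ?_
      nlinarith
    calc _ ≤ 2 * (L * (L * ((Fintype.card F : ℝ) ^ (((L : ℝ) + 1) * L) *
          ((2 : ℝ) ^ (((L : ℝ) + 1) * n) * (Fintype.card F : ℝ) ^ ((k : ℝ) * n - ε * n))))) :=
          mul_le_mul_of_nonneg_left h zero_le_two
      _ = (2 * (L * L)) * (2 : ℝ) ^ (((L : ℝ) + 1) * n) *
          ((Fintype.card F : ℝ) ^ (((L : ℝ) + 1) * L) *
          (Fintype.card F : ℝ) ^ ((k : ℝ) * n - ε * n)) := by ring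
      _ ≤ 2 ^ (2 * (L * n) : ℝ) * 2 ^ (2 * (L * n) : ℝ) *
          (2 ^ (-(5 * (L * n)) : ℝ) * (Fintype.card F : ℝ) ^ ((k : ℝ) * n)) := by gcongr
      _ = _ := by
        rw [← mul_assoc, ← Real.rpow_add two_pos, ← Real.rpow_add two_pos]
        ring_nf
  constructor
  · rw [randomMatrixProb_eq_one_sub]
    refine sub_le_sub_left ?_ 1
    rw [div_le_iff₀ hqkn]
    refine le_trans ?_ hbad
    rw [two_mul]
    exact le_add_of_nonneg_left (Nat.cast_nonneg _)
  · intro hRε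
    have hrank : 2 * ({G : Matrix (Fin k) (Fin n) F |
        Module.finrank F (rowCode G) ≠ k}.ncard : ℝ) ≤
        2 ^ (-(L * n) : ℝ) * (Fintype.card F : ℝ) ^ ((k : ℝ) * n) := by
      have hkn : (k : ℝ) - n ≤ -(ε * n / 2) := by
        have := (abs_lt.1 hk).2
        nlinarith
      calc _ ≤ 2 * (Fintype.card F : ℝ) ^ ((k : ℝ) * n + k - n) :=
            mul_le_mul_of_nonneg_left ncard_finrank_rowCode_ne_le zero_le_two
        _ ≤ 2 * ((Fintype.card F : ℝ) ^ (-(ε * n / 2)) *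
            (Fintype.card F : ℝ) ^ ((k : ℝ) * n)) := by
          rw [← Real.rpow_add hq0]
          refine mul_le_mul_of_nonneg_left (Real.rpow_le_rpow_of_exponent_le hq1 ?_) zero_le_two
          linarith
        _ ≤ 2 * ((2 : ℝ) ^ (-(5 * (L * n)) : ℝ) * (Fintype.card F : ℝ) ^ ((k : ℝ) * n)) := by
          gcongr
        _ = (2 : ℝ) ^ (1 + -(5 * (L * n)) : ℝ) * (Fintype.card F : ℝ) ^ ((k : ℝ) * n) := by
          rw [Real.rpow_add two_pos, Real.rpow_one, mul_assoc]
        _ ≤ _ := by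
          refine mul_le_mul_of_nonneg_right
            (Real.rpow_le_rpow_of_exponent_le one_le_two ?_) hqkn.le
          linarith
    rw [randomMatrixProb_eq_one_sub]
    refine sub_le_sub_left ?_ 1
    rw [div_le_iff₀ hqkn]
    have hunion : ({G : Matrix (Fin k) (Fin n) F | Module.finrank F (rowCode G) = k ∧
        IsRLDMDSLe (rowCode G) (ε * n) L}ᶜ.ncard : ℝ) ≤
        ({G : Matrix (Fin k) (Fin n) F | Module.finrank F (rowCode G) ≠ k}.ncard : ℝ) +
        ({G : Matrix (Fin k) (Fin n) F | ¬ IsRLDMDSLe (rowCode G) (ε * n) L}.ncard : ℝ) := by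
      have h : {G : Matrix (Fin k) (Fin n) F | Module.finrank F (rowCode G) = k ∧
          IsRLDMDSLe (rowCode G) (ε * n) L}ᶜ =
          {G | Module.finrank F (rowCode G) ≠ k} ∪
          {G | ¬ IsRLDMDSLe (rowCode G) (ε * n) L} := Set.ext fun G => not_and_or
      rw [h]
      exact_mod_cast Set.ncard_union_le _ _
    linarith
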